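/- There is no Lebesgue measurable set $S \subseteq \mathbb{R}^2$ such that, for almost every point $p \in \mathbb{R}^2$ (with respect to Lebesgue measure), almost every line $L$ through $p$ satisfies $|S \cap L| = 1$. Here $|\cdot|$ is one-dimensional Lebesgue measure on $L$, and "almost every line through $p$" refers to Lebesgue measure on the angle $\theta \in [0,\pi)$ that parametrizes the lines $\{p + t(\cos\theta, \sin\theta) : t \in \mathbb{R}\}$ through $p$. -/

import Mathlib

open MeasureTheory

/-- The unit vector `(cos θ, sin θ)` of the Euclidean plane. -/
noncomputable def unitDirection (θ : ℝ) : EuclideanSpace ℝ (Fin 2) :=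
  !₂[Real.cos θ, Real.sin θ]

/-- The line through `p` that forms the angle `θ` with the `x`-axis. As `θ` runs over `[0, π)`,
each line through `p` occurs exactly once. -/
def lineThrough (p : EuclideanSpace ℝ (Fin 2)) (θ : ℝ) : Set (EuclideanSpace ℝ (Fin 2)) :=
  Set.range fun t : ℝ => p + t • unitDirection θ

/-- `P L` holds for almost every line `L` through `p`: the lines through `p` are parametrized by
their angle `θ ∈ [0, π)`, and "almost every" is meant for Lebesgue measure in `θ`. -/
def ForAlmostEveryLineThrough (p : EuclideanSpace ℝ (Fin 2))
    (P : Set (EuclideanSpace ℝ (Fin 2)) → Prop) : Prop :=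
  ∀ᵐ θ : ℝ ∂(volume.restrict (Set.Ico 0 Real.pi)), P (lineThrough p θ)

/-- The one-dimensional measure (length) of a subset of the plane, here of a subset of a line:
the one-dimensional Hausdorff measure, which on each line is one-dimensional Lebesgue measure. -/
noncomputable def linearMeasure (A : Set (EuclideanSpace ℝ (Fin 2))) : ENNReal :=
  Measure.hausdorffMeasure 1 A

open scoped ENNReal Real

/-! In polar coordinates about `p` the Jacobian `r` cancels the kernel, so the potential `u p = ∫_S
1/|z - p| dz` is the integral over `θ` of the lengths of the sections of `S` through `p`. The
hypothesis thus gives `u = π` almost everywhere. Averaged over a ball of radius `R` about a point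
`p₀` with `u p₀ = π`, the kernel is at most `12 * min (1/R) (1/|z - p₀|)`. The average of `u` stays
`π`, while the integral of this bound over `S` tends to `0` as `R → ∞` by dominated convergence,
which is absurd. -/

theorem norm_unitDirection (θ : ℝ) : ‖unitDirection θ‖ = 1 := by
  simp [unitDirection, EuclideanSpace.norm_eq]

theorem continuous_unitDirection : Continuous unitDirection := by
  unfold unitDirection
  fun_prop

theorem unitDirection_add_pi (θ : ℝ) : unitDirection (θ + π) = -unitDirection θ := by
  ext i
  fin_cases i <;> simp [unitDirection]

/-- The length of a section by a line, as a measure on the parameter of the line. -/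
theorem linearMeasure_inter_lineThrough (T : Set (EuclideanSpace ℝ (Fin 2)))
    (p : EuclideanSpace ℝ (Fin 2)) (θ : ℝ) :
    linearMeasure (T ∩ lineThrough p θ) = volume {t : ℝ | p + t • unitDirection θ ∈ T} := by
  have hiso : Isometry fun t : ℝ => p + t • unitDirection θ := by
    refine Isometry.of_dist_eq fun s t => ?_
    rw [dist_add_left, dist_eq_norm, ← sub_smul, norm_smul, norm_unitDirection, mul_one,
      Real.dist_eq, Real.norm_eq_abs]
  rw [linearMeasure, lineThrough, ← hiso.hausdorffMeasure_preimage (Or.inl zero_le_one),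
    hausdorffMeasure_real]
  rfl

/-- Integration over the plane in polar coordinates. -/
theorem lintegral_eq_lintegral_polar {f : EuclideanSpace ℝ (Fin 2) → ℝ≥0∞} (hf : Measurable f) :
    ∫⁻ z, f z = ∫⁻ θ in Set.Ioo (-π) π, ∫⁻ r in Set.Ioi (0 : ℝ),
      ENNReal.ofReal r * f (r • unitDirection θ) := by
  have hmeas : Measurable fun q : ℝ × ℝ => ENNReal.ofReal q.1 * f (q.1 • unitDirection q.2) :=
    (by fun_prop : Measurable fun q : ℝ × ℝ => ENNReal.ofReal q.1).mul
      (hf.comp (continuous_fst.smul (continuous_unitDirection.comp continuous_snd)).measurable)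
  have hpolar : ∫⁻ z, f z = ∫⁻ q in Set.Ioi (0 : ℝ) ×ˢ Set.Ioo (-π) π,
      ENNReal.ofReal q.1 * f (q.1 • unitDirection q.2) := by
    rw [← Complex.orthonormalBasisOneI.measurePreserving_repr.lintegral_comp hf,
      ← Complex.lintegral_comp_polarCoord_symm, polarCoord_target]
    refine lintegral_congr fun q => ?_
    rw [smul_eq_mul]
    congr 2
    ext i
    fin_cases i <;> simp [unitDirection, Complex.orthonormalBasisOneI_repr_apply,
      -Complex.ofReal_cos, -Complex.ofReal_sin]
  rw [hpolar, Measure.volume_eq_prod, ← Measure.prod_restrict,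
    lintegral_prod_symm _ hmeas.aemeasurable]

/-- The integral over all directions of a quantity on rays is the integral over all lines. -/
theorem lintegral_directions_eq_lintegral_lines {f : EuclideanSpace ℝ (Fin 2) → ℝ≥0∞}
    (hf : Measurable f) :
    ∫⁻ θ in Set.Ioo (-π) π, ∫⁻ r in Set.Ioi (0 : ℝ), f (r • unitDirection θ) =
      ∫⁻ θ in Set.Ico 0 π, ∫⁻ t : ℝ, f (t • unitDirection θ) := by
  have hmeas : Measurable fun q : ℝ × ℝ => f (q.2 • unitDirection q.1) :=
    hf.comp (continuous_snd.smul (continuous_unitDirection.comp continuous_fst)).measurable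
  -- The pole cuts each line into two opposite rays; the second has angle `θ - π`, so these angles
  -- fill `[-π, 0)`.
  have hsplit : ∀ θ : ℝ, ∫⁻ t : ℝ, f (t • unitDirection θ) =
      (∫⁻ r in Set.Ioi (0 : ℝ), f (r • unitDirection θ)) +
        ∫⁻ r in Set.Ioi (0 : ℝ), f (r • unitDirection (θ + -π)) := by
    intro θ
    rw [← lintegral_add_compl _ measurableSet_Ioi (μ := volume) (A := Set.Ioi (0 : ℝ)),
      Set.compl_Ioi]
    congr 1
    rw [← (Measure.measurePreserving_neg (volume : Measure ℝ)).setLIntegral_comp_preimage_emb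
      (MeasurableEquiv.neg ℝ).measurableEmbedding]
    have : (Neg.neg ⁻¹' Set.Iic (0 : ℝ)) = Set.Ici 0 := by simp
    rw [this, setLIntegral_congr Ioi_ae_eq_Ici.symm]
    refine lintegral_congr fun r => ?_
    have h := unitDirection_add_pi (θ + -π)
    rw [neg_add_cancel_right] at h
    rw [h, smul_neg, neg_smul, neg_neg]
  simp_rw [hsplit]
  have hg : Measurable fun θ : ℝ => ∫⁻ r in Set.Ioi (0 : ℝ), f (r • unitDirection θ) :=
    hmeas.lintegral_prod_right'
  rw [lintegral_add_left hg]
  have hshift : ∫⁻ θ in Set.Ico 0 π, ∫⁻ r in Set.Ioi (0 : ℝ), f (r • unitDirection (θ + -π)) =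
      ∫⁻ θ in Set.Ico (-π) 0, ∫⁻ r in Set.Ioi (0 : ℝ), f (r • unitDirection θ) := by
    have h := (measurePreserving_add_right (volume : Measure ℝ) (-π)).setLIntegral_comp_preimage_emb
      (MeasurableEquiv.addRight (-π)).measurableEmbedding
      (fun θ => ∫⁻ r in Set.Ioi (0 : ℝ), f (r • unitDirection θ)) (Set.Ico (-π) 0)
    simpa using h
  rw [hshift, add_comm, setLIntegral_congr Ioo_ae_eq_Ico,
    ← Set.Ico_union_Ico_eq_Ico (neg_nonpos.2 Real.pi_nonneg) Real.pi_nonneg,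
    lintegral_union measurableSet_Ico]
  exact Set.Ico_disjoint_Ico_same

/-- The potential of a measurable set with kernel `1 / |z|` is the integral of the lengths of its
sections by the lines through the pole. -/
theorem setLIntegral_inv_enorm_sub {T : Set (EuclideanSpace ℝ (Fin 2))} (hT : MeasurableSet T)
    (p : EuclideanSpace ℝ (Fin 2)) :
    ∫⁻ z in T, ‖z - p‖ₑ⁻¹ = ∫⁻ θ in Set.Ico 0 π, linearMeasure (T ∩ lineThrough p θ) := by
  set g : EuclideanSpace ℝ (Fin 2) → ℝ≥0∞ := ((fun w => p + w) ⁻¹' T).indicator 1 with hg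
  have hgm : Measurable g := measurable_one.indicator (hT.preimage (by fun_prop))
  calc ∫⁻ z in T, ‖z - p‖ₑ⁻¹
      = ∫⁻ w, g w * ‖w‖ₑ⁻¹ := by
        rw [← lintegral_indicator hT,
          ← lintegral_add_left_eq_self (T.indicator fun z => ‖z - p‖ₑ⁻¹) p]
        refine lintegral_congr fun w => ?_
        by_cases hw : p + w ∈ T <;> simp [hg, hw]
    _ = ∫⁻ θ in Set.Ioo (-π) π, ∫⁻ r in Set.Ioi (0 : ℝ), g (r • unitDirection θ) := by
        rw [lintegral_eq_lintegral_polar (f := fun w => g w * ‖w‖ₑ⁻¹) (by fun_prop)]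
        refine lintegral_congr fun θ => setLIntegral_congr_fun measurableSet_Ioi fun r hr => ?_
        have hr' : (0 : ℝ) < r := hr
        have hnorm : ‖r • unitDirection θ‖ₑ = ENNReal.ofReal r := by
          rw [← ofReal_norm, norm_smul, norm_unitDirection, mul_one, Real.norm_of_nonneg hr'.le]
        simp only [hnorm]
        rw [mul_left_comm, ENNReal.mul_inv_cancel (by simpa using hr') ENNReal.ofReal_ne_top,
          mul_one]
    _ = ∫⁻ θ in Set.Ico 0 π, ∫⁻ t : ℝ, g (t • unitDirection θ) :=
        lintegral_directions_eq_lintegral_lines hgm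
    _ = ∫⁻ θ in Set.Ico 0 π, linearMeasure (T ∩ lineThrough p θ) := by
        refine lintegral_congr fun θ => ?_
        rw [linearMeasure_inter_lineThrough, ← lintegral_indicator_one]
        · rfl
        · exact hT.preimage (f := fun t : ℝ => p + t • unitDirection θ) (by fun_prop)

/-- Every line through the centre meets the ball in length `2 * ρ`. -/
theorem lintegral_ball_inv_enorm (ρ : ℝ) :
    ∫⁻ z in Metric.ball (0 : EuclideanSpace ℝ (Fin 2)) ρ, ‖z‖ₑ⁻¹ =
      ENNReal.ofReal (2 * ρ) * ENNReal.ofReal π := by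
  have h := setLIntegral_inv_enorm_sub (Metric.isOpen_ball (x := 0) (ε := ρ)).measurableSet 0
  simp_rw [sub_zero] at h
  rw [h]
  have hline : ∀ θ : ℝ, linearMeasure (Metric.ball 0 ρ ∩ lineThrough 0 θ) =
      ENNReal.ofReal (2 * ρ) := by
    intro θ
    rw [linearMeasure_inter_lineThrough, ← Real.volume_ball 0 ρ]
    congr 1
    ext t
    simp [norm_smul, norm_unitDirection]
  simp [hline]

theorem setLIntegral_inv_enorm_sub_eq_pi {S : Set (EuclideanSpace ℝ (Fin 2))}
    (hS : NullMeasurableSet S) {p : EuclideanSpace ℝ (Fin 2)}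
    (hp : ForAlmostEveryLineThrough p fun L => linearMeasure (S ∩ L) = 1) :
    ∫⁻ z in S, ‖z - p‖ₑ⁻¹ = ENNReal.ofReal π := by
  have hpi : ∫⁻ θ in Set.Ico 0 π, linearMeasure (S ∩ lineThrough p θ) = ENNReal.ofReal π := by
    rw [lintegral_congr_ae hp]
    simp
  have hmono : ∀ {A B : Set (EuclideanSpace ℝ (Fin 2))}, A ⊆ B →
      ∫⁻ θ in Set.Ico 0 π, linearMeasure (A ∩ lineThrough p θ) ≤
        ∫⁻ θ in Set.Ico 0 π, linearMeasure (B ∩ lineThrough p θ) := fun hAB =>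
    lintegral_mono fun θ => measure_mono (Set.inter_subset_inter_left _ hAB)
  -- Squeezing `S` between measurable sets suffices: the potential ignores null sets, and the
  -- integral of section lengths is monotone in the set.
  obtain ⟨T, hTS, hTm, hT⟩ := hS.exists_measurable_subset_ae_eq
  obtain ⟨U, hSU, hUm, hU⟩ := hS.exists_measurable_superset_ae_eq
  apply le_antisymm
  · rw [← setLIntegral_congr hT, setLIntegral_inv_enorm_sub hTm, ← hpi]
    exact hmono hTS
  · rw [← setLIntegral_congr hU, setLIntegral_inv_enorm_sub hUm, ← hpi]
    exact hmono hSU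

theorem volume_ball_eq_ofReal {R : ℝ} (hR : 0 ≤ R) (p : EuclideanSpace ℝ (Fin 2)) :
    volume (Metric.ball p R) = ENNReal.ofReal (π * R ^ 2) := by
  rw [EuclideanSpace.volume_ball_fin_two, mul_comm π, ENNReal.ofReal_mul (by positivity),
    ENNReal.ofReal_pow hR]

/-- Near the pole and far from it, the integral of the kernel over a ball is controlled. -/
theorem lintegral_ball_inv_enorm_sub_le {R : ℝ} (hR : 0 < R) (p₀ z : EuclideanSpace ℝ (Fin 2)) :
    ∫⁻ p in Metric.ball p₀ R, ‖z - p‖ₑ⁻¹ ≤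
      ENNReal.ofReal (12 * π * R ^ 2) * min (ENNReal.ofReal R⁻¹) ‖z - p₀‖ₑ⁻¹ := by
  -- Near `p₀`, the ball lies in the ball of radius `3 * R` about `z`, where the kernel has integral
  -- `6πR = 12πR² / (2R)`; this fixes the constant 12. Far away, `‖z - p‖ ≥ ‖z - p₀‖ / 2` on the
  -- ball.
  rcases lt_or_ge ‖z - p₀‖ (2 * R) with hz | hz
  · have hsub : Metric.ball p₀ R ⊆ (fun p => z - p) ⁻¹' Metric.ball 0 (3 * R) := by
      intro p hp
      rw [Metric.mem_ball, dist_eq_norm] at hp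
      have := norm_sub_le (z - p₀) (p - p₀)
      rw [sub_sub_sub_cancel_right] at this
      simp only [Set.mem_preimage, mem_ball_zero_iff]
      linarith
    have hmin : ENNReal.ofReal (2 * R)⁻¹ ≤ min (ENNReal.ofReal R⁻¹) ‖z - p₀‖ₑ⁻¹ := by
      refine le_min (ENNReal.ofReal_le_ofReal (by gcongr; linarith)) ?_
      rw [ENNReal.ofReal_inv_of_pos (by positivity), ← ofReal_norm]
      exact ENNReal.inv_le_inv.2 (ENNReal.ofReal_le_ofReal hz.le)
    calc ∫⁻ p in Metric.ball p₀ R, ‖z - p‖ₑ⁻¹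
        ≤ ∫⁻ p in (fun p => z - p) ⁻¹' Metric.ball 0 (3 * R), ‖z - p‖ₑ⁻¹ :=
          lintegral_mono_set hsub
      _ = ENNReal.ofReal (2 * (3 * R)) * ENNReal.ofReal π := by
          rw [← lintegral_ball_inv_enorm]
          exact (Measure.measurePreserving_sub_left volume z).setLIntegral_comp_preimage
            Metric.isOpen_ball.measurableSet (f := fun w => ‖w‖ₑ⁻¹) (by fun_prop)
      _ = ENNReal.ofReal (12 * π * R ^ 2) * ENNReal.ofReal (2 * R)⁻¹ := by
          rw [← ENNReal.ofReal_mul (by positivity), ← ENNReal.ofReal_mul (by positivity)]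
          congr 1
          field_simp
          norm_num
      _ ≤ _ := by gcongr
  · have hd : 0 < ‖z - p₀‖ := by linarith
    have hmin : ENNReal.ofReal ‖z - p₀‖⁻¹ ≤ min (ENNReal.ofReal R⁻¹) ‖z - p₀‖ₑ⁻¹ := by
      refine le_min (ENNReal.ofReal_le_ofReal (by gcongr; linarith)) ?_
      rw [ENNReal.ofReal_inv_of_pos hd, ofReal_norm]
    calc ∫⁻ p in Metric.ball p₀ R, ‖z - p‖ₑ⁻¹
        ≤ ∫⁻ _ in Metric.ball p₀ R, ENNReal.ofReal (‖z - p₀‖ / 2)⁻¹ := by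
          refine setLIntegral_mono measurable_const fun p hp => ?_
          rw [Metric.mem_ball, dist_eq_norm] at hp
          have := norm_sub_norm_le (z - p₀) (p - p₀)
          rw [sub_sub_sub_cancel_right] at this
          rw [ENNReal.ofReal_inv_of_pos (by positivity), ← ofReal_norm]
          exact ENNReal.inv_le_inv.2 (ENNReal.ofReal_le_ofReal (by linarith))
      _ = ENNReal.ofReal (2 * π * R ^ 2) * ENNReal.ofReal ‖z - p₀‖⁻¹ := by
          rw [setLIntegral_const, volume_ball_eq_ofReal hR.le,
            ← ENNReal.ofReal_mul (by positivity), ← ENNReal.ofReal_mul (by positivity)]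
          congr 1
          field_simp
      _ ≤ _ := by
          gcongr
          norm_num

theorem mainTheorem3 :
    ¬ ∃ S : Set (EuclideanSpace ℝ (Fin 2)),
      NullMeasurableSet S (volume : Measure (EuclideanSpace ℝ (Fin 2))) ∧
      ∀ᵐ p : EuclideanSpace ℝ (Fin 2) ∂volume,
        ForAlmostEveryLineThrough p (fun L => linearMeasure (S ∩ L) = 1) := by
  rintro ⟨S, hS, h⟩
  have hpot : ∀ᵐ p : EuclideanSpace ℝ (Fin 2), ∫⁻ z in S, ‖z - p‖ₑ⁻¹ = ENNReal.ofReal π :=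
    h.mono fun p hp => setLIntegral_inv_enorm_sub_eq_pi hS hp
  obtain ⟨p₀, hp₀⟩ := hpot.exists
  have hmeas : Measurable fun q : EuclideanSpace ℝ (Fin 2) × EuclideanSpace ℝ (Fin 2) =>
      ‖q.2 - q.1‖ₑ⁻¹ := by fun_prop
  have hbound : ∀ n : ℕ, ENNReal.ofReal π ≤ ∫⁻ z in S,
      12 * min (ENNReal.ofReal ((n : ℝ) + 1)⁻¹) ‖z - p₀‖ₑ⁻¹ := by
    intro n
    have hR : (0 : ℝ) < n + 1 := by positivity
    -- Tonelli: the potential is `π` almost everywhere on the ball.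
    have hswap : ENNReal.ofReal π * volume (Metric.ball p₀ ((n : ℝ) + 1)) =
        ∫⁻ z in S, ∫⁻ p in Metric.ball p₀ ((n : ℝ) + 1), ‖z - p‖ₑ⁻¹ := by
      rw [← lintegral_lintegral_swap hmeas.aemeasurable,
        lintegral_congr_ae (ae_restrict_of_ae hpot)]
      simp
    have hvol : ENNReal.ofReal (π * ((n : ℝ) + 1) ^ 2) ≠ 0 := by
      rw [ENNReal.ofReal_ne_zero_iff]
      positivity
    rw [volume_ball_eq_ofReal hR.le] at hswap
    rw [← ENNReal.mul_le_mul_iff_left hvol ENNReal.ofReal_ne_top, hswap]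
    calc ∫⁻ z in S, ∫⁻ p in Metric.ball p₀ ((n : ℝ) + 1), ‖z - p‖ₑ⁻¹
        ≤ ∫⁻ z in S, ENNReal.ofReal (12 * π * ((n : ℝ) + 1) ^ 2) *
            min (ENNReal.ofReal ((n : ℝ) + 1)⁻¹) ‖z - p₀‖ₑ⁻¹ :=
          lintegral_mono fun z => lintegral_ball_inv_enorm_sub_le hR p₀ z
      _ = _ := by
          rw [lintegral_const_mul _ (by fun_prop), lintegral_const_mul _ (by fun_prop), mul_assoc,
            ENNReal.ofReal_mul (by norm_num), mul_right_comm, ENNReal.ofReal_ofNat]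
  have hlim : Filter.Tendsto (fun n : ℕ => ∫⁻ z in S,
      12 * min (ENNReal.ofReal ((n : ℝ) + 1)⁻¹) ‖z - p₀‖ₑ⁻¹) Filter.atTop
      (nhds (∫⁻ z in S, 0)) := by
    -- The dominating function has integral `12π` over `S`, by the choice of `p₀`.
    refine tendsto_lintegral_of_dominated_convergence (fun z => 12 * ‖z - p₀‖ₑ⁻¹)
      (fun n => by fun_prop)
      (fun n => .of_forall fun z => mul_le_mul_right (min_le_right _ _) _) ?_
      (.of_forall fun z => ?_)
    · rw [lintegral_const_mul _ (by fun_prop), hp₀]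
      finiteness
    · have hn : Filter.Tendsto (fun n : ℕ => ENNReal.ofReal ((n : ℝ) + 1)⁻¹) Filter.atTop
          (nhds 0) := by
        rw [← ENNReal.ofReal_zero]
        refine ENNReal.tendsto_ofReal ?_
        simpa using tendsto_one_div_add_atTop_nhds_zero_nat (𝕜 := ℝ)
      have h12 := ENNReal.Tendsto.const_mul (a := 12) hn (Or.inr (by finiteness))
      rw [mul_zero] at h12
      exact tendsto_of_tendsto_of_tendsto_of_le_of_le tendsto_const_nhds h12 (fun n => zero_le)
        (fun n => mul_le_mul_right (min_le_left _ _) _)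
  have hle := ge_of_tendsto' hlim hbound
  rw [lintegral_zero] at hle
  exact absurd hle (by simp [Real.pi_pos])
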